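/- Let $\mathbb{D}=\{z\in\mathbb{C}:|z|<1\}$. Let $f(z)=\sum_{n=1}^{\infty}a_nz^n$ be analytic in $\mathbb{D}$ and continuous on $\overline{\mathbb{D}}$, and assume that $f$ is proper as a map from $\mathbb{D}$ onto its image $f(\mathbb{D})$. Let $g(z)=\sum_{n=1}^{\infty}b_nz^n$ be analytic in $\mathbb{D}$ with $g(\mathbb{D})\subset f(\mathbb{D})$ and $b_1\neq 0$. Then there exists an integer $N>2$ such that $$\sum_{k=2}^{n}|b_k|^2\le\sum_{k=1}^{n}|a_k|^2\qquad\text{for all integers } n>N.$$ -/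

import Mathlib

open Filter Topology Metric Real

/-! Let M be the mean of |f|² over the unit circle. Littlewood subordination gives ∑_{k≤n} |b_k|² ≤
M for every n, while the sums ∑_{k≤n} |a_k|² eventually exceed M - |b_1|². Dropping the term |b_1|²
on the left therefore leaves enough slack.

As f need not be univalent, g = f ∘ ω defines ω only as a multivalued function. In its place stands
the fibre product {f(w) = g(z), |z| ≤ r}, compact because f is proper
(`IsProperMap.isCompact_fiberProduct`). Let Re F be the Poisson majorant of |f|², with Re F(0) = M,
and let Re Q equal |partial sum of g|² on |z| = r. By `IsProperMap.re_zero_le_add`, Re Q(z) - Re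
F(w) is controlled by its values over |z| = r, because `AnalyticAt.exists_lift_comp_pow`
parametrises a local branch of the fibre product. Comparison at (0, 0) gives ∑ |b_k|² r^(2k) ≤ M up
to a small error; then r → 1. -/

/-! ### Roots and Puiseux lifting of analytic germs -/

/-- A nonvanishing analytic germ has an analytic `n`-th root. -/
theorem AnalyticAt.exists_analyticAt_pow_eq {f : ℂ → ℂ} {x : ℂ} (hf : AnalyticAt ℂ f x)
    (h0 : f x ≠ 0) {n : ℕ} (hn : n ≠ 0) :
    ∃ v : ℂ → ℂ, AnalyticAt ℂ v x ∧ v x ≠ 0 ∧ ∀ᶠ z in 𝓝 x, v z ^ n = f z := by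
  obtain ⟨c, hc⟩ := IsAlgClosed.exists_pow_nat_eq (f x) (Nat.pos_of_ne_zero hn)
  have hc0 : c ≠ 0 := by
    rintro rfl
    exact h0 (by rw [← hc, zero_pow hn])
  -- Dividing by `f x` moves the central value to 1, away from the branch cut of the logarithm.
  have hq : AnalyticAt ℂ (fun z => f z / f x) x := hf.div analyticAt_const h0
  have hlog : AnalyticAt ℂ (fun z => Complex.log (f z / f x)) x :=
    hq.clog (by simp [div_self h0])
  refine ⟨fun z => c * Complex.exp (Complex.log (f z / f x) / n), ?_, ?_, ?_⟩
  · exact analyticAt_const.mul ((hlog.div analyticAt_const (by exact_mod_cast hn)).cexp)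
  · exact mul_ne_zero hc0 (Complex.exp_ne_zero _)
  · filter_upwards [hf.continuousAt.eventually_ne h0] with z hz
    have hn' : (n : ℂ) ≠ 0 := by exact_mod_cast hn
    rw [mul_pow, hc, ← Complex.exp_nat_mul, mul_div_cancel₀ _ hn',
      Complex.exp_log (div_ne_zero hz h0), mul_div_cancel₀ _ h0]

/-- Local normal form of a nonconstant analytic germ: a power of a local coordinate. -/
theorem AnalyticAt.exists_eq_add_coordinate_pow {f : ℂ → ℂ} {x : ℂ} (hf : AnalyticAt ℂ f x)
    (hnc : ¬ ∀ᶠ z in 𝓝 x, f z = f x) :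
    ∃ k : ℕ, k ≠ 0 ∧ ∃ ψ : ℂ → ℂ, AnalyticAt ℂ ψ x ∧ ψ x = 0 ∧ deriv ψ x ≠ 0 ∧
      ∀ᶠ z in 𝓝 x, f z = f x + ψ z ^ k := by
  have hsub : AnalyticAt ℂ (fun z => f z - f x) x := hf.sub analyticAt_const
  obtain ⟨k, u, hu, hu0, hfu⟩ := hsub.exists_eventuallyEq_pow_smul_nonzero_iff.mpr
    (by simpa [sub_eq_zero] using hnc)
  have hk : k ≠ 0 := by
    rintro rfl
    have := hfu.self_of_nhds
    simp at this
    exact hu0 this.symm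
  obtain ⟨v, hv, hv0, hvu⟩ := hu.exists_analyticAt_pow_eq hu0 hk
  have hd : HasDerivAt (fun z => (z - x) * v z) (v x) x := by
    have := ((hasDerivAt_id' x).sub_const x).fun_mul hv.differentiableAt.hasDerivAt
    simpa using this
  refine ⟨k, hk, fun z => (z - x) * v z, (analyticAt_id.sub analyticAt_const).mul hv, by simp,
    by rw [hd.deriv]; exact hv0, ?_⟩
  filter_upwards [hfu, hvu] with z h1 h2
  rw [mul_pow, h2, ← smul_eq_mul, ← h1]
  ring

/-- The substitution multiplies the vanishing order of `g - g z₀` by `k`, so that order is no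
obstruction to a `k`-th root; the remaining unit has a root anyway. -/
theorem AnalyticAt.exists_pow_eq_comp_pow_sub {g : ℂ → ℂ} {z₀ : ℂ} (hg : AnalyticAt ℂ g z₀)
    {k : ℕ} (hk : k ≠ 0) :
    ∃ χ : ℂ → ℂ, AnalyticAt ℂ χ 0 ∧ χ 0 = 0 ∧
      ∀ᶠ t in 𝓝 (0 : ℂ), χ t ^ k = g (z₀ + t ^ k) - g z₀ := by
  have hp : AnalyticAt ℂ (fun t : ℂ => z₀ + t ^ k) 0 := by fun_prop
  have hp0 : z₀ + (0 : ℂ) ^ k = z₀ := by simp [hk]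
  have ht : Tendsto (fun t : ℂ => z₀ + t ^ k) (𝓝 0) (𝓝 z₀) := by
    simpa [hk] using hp.continuousAt.tendsto
  by_cases hc : ∀ᶠ z in 𝓝 z₀, g z = g z₀
  · refine ⟨fun _ => 0, analyticAt_const, rfl, ?_⟩
    filter_upwards [ht.eventually hc] with t h
    simp [h, hk]
  · obtain ⟨j, hj, ψ, hψ, hψ0, hψ', hgψ⟩ := hg.exists_eq_add_coordinate_pow hc
    obtain ⟨m, q, hq, hq0, hψq⟩ := hψ.exists_eventuallyEq_pow_smul_nonzero_iff.mpr (by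
      intro h
      exact hψ' (by rw [EventuallyEq.deriv_eq (f := fun _ => (0 : ℂ)) h]; simp))
    have hm : m ≠ 0 := by
      rintro rfl
      have := hψq.self_of_nhds
      simp [hψ0] at this
      exact hq0 this.symm
    have hqp : AnalyticAt ℂ (fun t : ℂ => q (z₀ + t ^ k)) 0 :=
      AnalyticAt.fun_comp (by rwa [hp0]) hp
    obtain ⟨v, hv, hv0, hvq⟩ := hqp.exists_analyticAt_pow_eq (by simpa [hk] using hq0) hk
    refine ⟨fun t => (t ^ m * v t) ^ j, ((analyticAt_id.pow m).mul hv).pow j,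
      by simp [hm, hj], ?_⟩
    filter_upwards [hvq, ht.eventually hgψ, ht.eventually hψq] with t h1 h2 h3
    rw [h2, h3, add_sub_cancel_left, add_sub_cancel_left, smul_eq_mul, ← h1]
    ring

/-- Puiseux lifting: after the substitution `z = z₀ + t ^ k`, an analytic germ lifts through a
nonconstant analytic germ with the same value. -/
theorem AnalyticAt.exists_lift_comp_pow {f g : ℂ → ℂ} {x z₀ : ℂ} (hf : AnalyticAt ℂ f x)
    (hnc : ¬ ∀ᶠ z in 𝓝 x, f z = f x) (hg : AnalyticAt ℂ g z₀) (hfg : f x = g z₀) :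
    ∃ k : ℕ, k ≠ 0 ∧ ∃ η : ℂ → ℂ, AnalyticAt ℂ η 0 ∧ η 0 = x ∧
      ∀ᶠ t in 𝓝 (0 : ℂ), f (η t) = g (z₀ + t ^ k) := by
  obtain ⟨k, hk, ψ, hψ, hψ0, hψ', hfψ⟩ := hf.exists_eq_add_coordinate_pow hnc
  obtain ⟨χ, hχ, hχ0, hgχ⟩ := hg.exists_pow_eq_comp_pow_sub hk
  have hφ := hψ.analyticAt_localInverse hψ'
  have hφx : hψ.hasStrictDerivAt.localInverse _ _ _ hψ' (ψ x) = x :=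
    HasStrictFDerivAt.localInverse_apply_image ..
  have hφr := HasStrictDerivAt.eventually_right_inverse hψ.hasStrictDerivAt hψ'
  set φ := hψ.hasStrictDerivAt.localInverse _ _ _ hψ'
  rw [hψ0] at hφ hφx hφr
  -- In the coordinate `ψ`, `f` is `f x + ψ ^ k`, so it suffices to solve `ψ (η t) = χ t`.
  have hη : AnalyticAt ℂ (fun t => φ (χ t)) 0 := AnalyticAt.fun_comp (by rwa [hχ0]) hχ
  have hη0 : φ (χ 0) = x := by rw [hχ0, hφx]
  have hηt : Tendsto (fun t => φ (χ t)) (𝓝 0) (𝓝 x) := by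
    have := hη.continuousAt.tendsto
    rwa [hη0] at this
  have hχt : Tendsto χ (𝓝 0) (𝓝 0) := by
    have := hχ.continuousAt.tendsto
    rwa [hχ0] at this
  refine ⟨k, hk, fun t => φ (χ t), hη, hη0, ?_⟩
  filter_upwards [hηt.eventually hfψ, hχt.eventually hφr, hgχ] with t h1 h2 h3
  rw [h1, h2, h3, hfg]
  ring

/-! ### Maximum principle on the fibre product -/

/-- An analytic germ whose real part grows by at least `ε ‖t‖ ^ k` cannot peak at the centre. -/
theorem AnalyticAt.not_eventually_re_add_norm_pow_le {H : ℂ → ℂ} (hH : AnalyticAt ℂ H 0) {ε : ℝ}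
    (hε : 0 < ε) (k : ℕ) : ¬ ∀ᶠ t in 𝓝 (0 : ℂ), (H t).re + ε * ‖t‖ ^ k ≤ (H 0).re := by
  intro h
  obtain ⟨ρ, hρ, hb⟩ := Metric.eventually_nhds_iff_ball.mp (h.and hH.eventually_analyticAt)
  have hsub : closedBall (0 : ℂ) |ρ / 2| ⊆ ball 0 ρ := by
    rw [abs_of_pos (by positivity)]
    exact closedBall_subset_ball (by linarith)
  have hdiff : DifferentiableOn ℂ H (closedBall 0 |ρ / 2|) := fun z hz =>
    ((hb z (hsub hz)).2.differentiableAt).differentiableWithinAt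
  have hci : CircleIntegrable H 0 (ρ / 2) :=
    (hdiff.continuousOn.mono sphere_subset_closedBall).circleIntegrable'
  have hmean : circleAverage H 0 (ρ / 2) = H 0 :=
    circleAverage_of_differentiable_on_off_countable Set.countable_empty hdiff.continuousOn
      fun z hz => (hb z (hsub (ball_subset_closedBall hz.1))).2.differentiableAt
  have hre : circleAverage (fun z => (H z).re) 0 (ρ / 2) = (H 0).re := by
    rw [← hmean]
    exact Complex.reCLM.circleAverage_comp_comm hci
  have hle : circleAverage (fun z => (H z).re) 0 (ρ / 2) ≤ (H 0).re - ε * (ρ / 2) ^ k := by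
    apply circleAverage_mono_on_of_le_circle
    · exact (Complex.continuous_re.comp_continuousOn
        (hdiff.continuousOn.mono sphere_subset_closedBall)).circleIntegrable'
    · intro z hz
      have h1 := (hb z (hsub (sphere_subset_closedBall hz))).1
      have h2 : ‖z‖ = ρ / 2 := by
        rw [mem_sphere_zero_iff_norm, abs_of_pos (by positivity)] at hz
        exact hz
      rw [h2] at h1
      linarith
  have : 0 < ε * (ρ / 2) ^ k := by positivity
  linarith

/-- The part of the fibre product of `g` and a proper map `f` above a compact set is compact. -/
theorem IsProperMap.isCompact_fiberProduct {f g : ℂ → ℂ} {s K : Set ℂ}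
    (hf : IsProperMap (s.imageFactorization f)) (hfc : ContinuousOn f s) (hK : IsCompact K)
    (hgc : ContinuousOn g K) (hgf : g '' K ⊆ f '' s) :
    IsCompact {p : ℂ × ℂ | p.1 ∈ K ∧ p.2 ∈ s ∧ f p.2 = g p.1} := by
  have hT : IsCompact ((↑) ⁻¹' (g '' K) : Set (f '' s)) := by
    rw [Subtype.isCompact_iff, Subtype.image_preimage_coe, Set.inter_eq_right.mpr hgf]
    exact hK.image_of_continuousOn hgc
  -- `L` collects the points of `s` that `f` sends into `g '' K`; the fibre product is closed in the
  -- compact set `K ×ˢ L`.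
  have hL : IsCompact ((↑) '' (s.imageFactorization f ⁻¹' ((↑) ⁻¹' (g '' K))) : Set ℂ) :=
    (hf.isCompact_preimage hT).image continuous_subtype_val
  set L : Set ℂ := (↑) '' (s.imageFactorization f ⁻¹' ((↑) ⁻¹' (g '' K))) with hLdef
  have hLs : L ⊆ s := by
    rintro _ ⟨x, -, rfl⟩
    exact x.2
  have hKL := hK.prod hL
  have hcont : ContinuousOn (fun p : ℂ × ℂ => f p.2 - g p.1) (K ×ˢ L) :=
    ((hfc.mono hLs).comp continuousOn_snd fun p hp => hp.2).sub
      (hgc.comp continuousOn_fst fun p hp => hp.1)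
  have hcl := hcont.preimage_isClosed_of_isClosed hKL.isClosed (isClosed_singleton (x := (0 : ℂ)))
  convert hKL.of_isClosed_subset hcl Set.inter_subset_left using 1
  ext ⟨z, w⟩
  simp only [Set.mem_ofPred_eq, Set.mem_inter_iff, Set.mem_prod, Set.mem_preimage,
    Set.mem_singleton_iff, sub_eq_zero]
  constructor
  · rintro ⟨hz, hw, h⟩
    exact ⟨⟨hz, ⟨⟨w, hw⟩, ⟨z, hz, h.symm⟩, rfl⟩⟩, h⟩
  · rintro ⟨⟨hz, hw⟩, h⟩
    exact ⟨hz, hLs hw, h⟩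

/-- Maximum principle for subordination to a proper holomorphic map: a harmonic majorant upstairs
controls harmonic minorants on the boundary of a smaller disc. -/
theorem IsProperMap.re_zero_le_add {f g F Q : ℂ → ℂ} {φ : ℂ → ℝ} {r δ : ℝ}
    (hfp : IsProperMap ((ball (0 : ℂ) 1).imageFactorization f))
    (hf : DifferentiableOn ℂ f (ball 0 1))
    (hnc : ∀ x ∈ ball (0 : ℂ) 1, ¬ ∀ᶠ z in 𝓝 x, f z = f x)
    (hg : DifferentiableOn ℂ g (ball 0 1)) (hgf : g '' ball 0 1 ⊆ f '' ball 0 1)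
    (hfg : f 0 = g 0) (hF : DifferentiableOn ℂ F (ball 0 1))
    (hFf : ∀ w ∈ ball (0 : ℂ) 1, φ (f w) ≤ (F w).re)
    (hQ : DifferentiableOn ℂ Q (ball 0 1)) (hr : 0 < r) (hr1 : r < 1)
    (hQg : ∀ z ∈ sphere (0 : ℂ) r, (Q z).re ≤ φ (g z) + δ) :
    (Q 0).re ≤ (F 0).re + δ := by
  refine le_of_forall_pos_le_add fun ε hε => ?_
  have hKD : closedBall (0 : ℂ) r ⊆ ball 0 1 := closedBall_subset_ball hr1
  have hS := hfp.isCompact_fiberProduct hf.continuousOn (isCompact_closedBall (0 : ℂ) r)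
    (hg.continuousOn.mono hKD) ((Set.image_mono hKD).trans hgf)
  set S := {p : ℂ × ℂ | p.1 ∈ closedBall (0 : ℂ) r ∧ p.2 ∈ ball (0 : ℂ) 1 ∧ f p.2 = g p.1}
  have h0S : ((0 : ℂ), (0 : ℂ)) ∈ S := ⟨by simp [hr.le], by simp, hfg⟩
  -- The term `ε * ‖z‖ ^ 2` makes the function strictly subharmonic in `z`, excluding an interior
  -- maximum at a total cost of at most `ε`.
  have hΨ : ContinuousOn (fun p : ℂ × ℂ => (Q p.1).re - (F p.2).re + ε * ‖p.1‖ ^ 2) S := by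
    have h1 : ContinuousOn (fun p : ℂ × ℂ => Q p.1) S :=
      hQ.continuousOn.comp continuousOn_fst fun p hp => hKD hp.1
    have h2 : ContinuousOn (fun p : ℂ × ℂ => F p.2) S :=
      hF.continuousOn.comp continuousOn_snd fun p hp => hp.2.1
    exact ((Complex.continuous_re.comp_continuousOn h1).sub
      (Complex.continuous_re.comp_continuousOn h2)).add (by fun_prop)
  obtain ⟨⟨z₀, w₀⟩, ⟨hz₀, hw₀, hfgw⟩, hmax⟩ := hS.exists_isMaxOn ⟨_, h0S⟩ hΨ
  simp only at hz₀ hw₀ hfgw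
  have h0 := hmax h0S
  simp only [Set.mem_ofPred_eq, norm_zero] at h0
  rcases (mem_closedBall_zero_iff.mp hz₀).lt_or_eq with hlt | heq
  · exfalso
    have hz₀D : z₀ ∈ ball (0 : ℂ) 1 := hKD hz₀
    obtain ⟨k, hk, η, hη, hη0, hlift⟩ :=
      (hf.analyticAt (isOpen_ball.mem_nhds hw₀)).exists_lift_comp_pow (hnc _ hw₀)
        (hg.analyticAt (isOpen_ball.mem_nhds hz₀D)) hfgw
    have hp : AnalyticAt ℂ (fun t : ℂ => z₀ + t ^ k) 0 := by fun_prop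
    have hp0 : z₀ + (0 : ℂ) ^ k = z₀ := by simp [hk]
    -- Expanding `ε * ‖z₀ + t ^ k‖ ^ 2` gives a constant, the real part of the last term here, and
    -- `ε * ‖t‖ ^ (k * 2)`, which is the growth that contradicts maximality.
    have hH : AnalyticAt ℂ (fun t => Q (z₀ + t ^ k) - F (η t)
        + 2 * ε * (starRingEnd ℂ z₀ * t ^ k)) 0 := by
      refine ((AnalyticAt.fun_comp ?_ hp).sub (AnalyticAt.fun_comp ?_ hη)).add (by fun_prop)
      · rw [hp0]; exact hQ.analyticAt (isOpen_ball.mem_nhds hz₀D)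
      · rw [hη0]; exact hF.analyticAt (isOpen_ball.mem_nhds hw₀)
    refine hH.not_eventually_re_add_norm_pow_le hε (k * 2) ?_
    have e1 : ∀ᶠ t in 𝓝 (0 : ℂ), z₀ + t ^ k ∈ ball (0 : ℂ) r :=
      hp.continuousAt.eventually_mem (isOpen_ball.mem_nhds (by simpa [hk] using hlt))
    have e2 : ∀ᶠ t in 𝓝 (0 : ℂ), η t ∈ ball (0 : ℂ) 1 :=
      hη.continuousAt.eventually_mem (isOpen_ball.mem_nhds (by rwa [hη0]))
    filter_upwards [hlift, e1, e2] with t h1 h2 h3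
    have := hmax (show (z₀ + t ^ k, η t) ∈ S from ⟨ball_subset_closedBall h2, h3, h1⟩)
    simp only [Set.mem_ofPred_eq] at this
    have hexp : ‖z₀ + t ^ k‖ ^ 2
        = ‖z₀‖ ^ 2 + 2 * (starRingEnd ℂ z₀ * t ^ k).re + ‖t‖ ^ (k * 2) := by
      rw [pow_mul, ← norm_pow t]
      generalize t ^ k = u
      rw [← Complex.normSq_eq_norm_sq, ← Complex.normSq_eq_norm_sq, ← Complex.normSq_eq_norm_sq,
        Complex.normSq_add]
      simp only [Complex.mul_re, Complex.conj_re, Complex.conj_im]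
      ring
    have hre : (2 * (ε : ℂ) * (starRingEnd ℂ z₀ * t ^ k)).re
        = 2 * ε * (starRingEnd ℂ z₀ * t ^ k).re := by
      rw [show (2 * (ε : ℂ)) = ((2 * ε : ℝ) : ℂ) by push_cast; rfl, Complex.re_ofReal_mul]
    rw [hexp] at this
    simp only [Complex.add_re, Complex.sub_re, hre, hp0, hη0]
    simp only [zero_pow hk, mul_zero, Complex.zero_re]
    linarith
  · have hb := hQg z₀ (by simpa using heq)
    have hm := hFf w₀ hw₀
    rw [hfgw] at hm
    have : ε * ‖z₀‖ ^ 2 ≤ ε * 1 := by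
      gcongr
      rw [heq]
      exact pow_le_one₀ hr.le hr1.le
    linarith

/-! ### Harmonic majorants and circle means -/

open Complex in
/-- The squared modulus of a function holomorphic in the disc and continuous up to the boundary has
a harmonic majorant, the real part of a holomorphic function, whose value at the centre is the
boundary mean. -/
theorem DiffContOnCl.exists_norm_sq_le_re {f : ℂ → ℂ} (hf : DiffContOnCl ℂ f (ball 0 1)) :
    ∃ F : ℂ → ℂ, DifferentiableOn ℂ F (ball 0 1) ∧
      (∀ w ∈ ball (0 : ℂ) 1, ‖f w‖ ^ 2 ≤ (F w).re) ∧
      (F 0).re = Real.circleAverage (fun z => ‖f z‖ ^ 2) 0 1 := by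
  have hfs : ContinuousOn f (sphere 0 |1|) := by
    rw [abs_one]
    exact hf.continuousOn_ball.mono sphere_subset_closedBall
  have hcu : ContinuousOn (fun z => ‖f z‖ ^ 2) (sphere 0 |1|) := hfs.norm.pow 2
  have hci : CircleIntegrable (fun z => ‖f z‖ ^ 2) 0 1 := hcu.circleIntegrable'
  have hci' : CircleIntegrable (fun z => ((‖f z‖ ^ 2 : ℝ) : ℂ)) 0 1 :=
    (continuous_ofReal.comp_continuousOn hcu).circleIntegrable'
  -- `F` is the Herglotz integral of the boundary values of |f|²; its real part is their Poisson
  -- integral.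
  refine ⟨_, differentiableOn_circleAverage_herglotzRieszKernel_smul hci', fun w hw => ?_, ?_⟩
  · rw [re_circleAverage_herglotzRieszKernel_smul hci hw, ← poissonKernel_eq_re_herglotzRieszKernel]
    have hwn : ‖w‖ < 1 := by simpa using hw
    have hK : ContinuousOn (poissonKernel 0 w) (sphere 0 |1|) := by
      unfold poissonKernel
      refine ContinuousOn.div (by fun_prop) (by fun_prop) fun z hz => ?_
      have hz1 : ‖z‖ = 1 := by simpa using hz
      refine pow_ne_zero 2 (norm_ne_zero_iff.mpr ?_)
      rw [sub_zero, sub_zero, sub_ne_zero]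
      rintro rfl
      linarith
    have hK0 : ∀ z ∈ sphere (0 : ℂ) |1|, 0 ≤ poissonKernel 0 w z := by
      intro z hz
      have hz1 : ‖z‖ = 1 := by simpa using hz
      rw [poissonKernel_def, sub_zero, sub_zero, hz1]
      have : ‖w‖ ^ 2 ≤ 1 := pow_le_one₀ (norm_nonneg _) hwn.le
      exact div_nonneg (by linarith) (by positivity)
    set c := f w
    -- Tangent-plane form of Jensen's inequality: |u|² ≥ 2 Re(c̄u) - |c|², with equality at u = c.
    -- At u = f(z) the right side is Re h(z), which the Poisson kernel reproduces.
    have hh : DiffContOnCl ℂ (fun z => 2 * starRingEnd ℂ c * f z - ‖c‖ ^ 2) (ball 0 1) :=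
      (hf.const_smul (2 * starRingEnd ℂ c)).sub_const _
    set h : ℂ → ℂ := fun z => 2 * starRingEnd ℂ c * f z - ‖c‖ ^ 2 with hdef
    have hpois : Real.circleAverage (poissonKernel 0 w • h) 0 1 = h w :=
      hh.circleAverage_poissonKernel_smul hw
    have hhs : ContinuousOn h (sphere 0 |1|) := by fun_prop
    have hre : ∀ z, (h z).re = 2 * (starRingEnd ℂ c * f z).re - ‖c‖ ^ 2 := by
      intro z
      rw [hdef]
      simp only [Complex.sub_re, mul_assoc]
      rw [← ofReal_pow, ofReal_re]
      congr 1
      exact re_ofReal_mul 2 _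
    have hw' : (h w).re = ‖c‖ ^ 2 := by
      rw [hre, conj_mul', ← ofReal_pow, ofReal_re]
      ring
    rw [← hw', ← hpois]
    have hcomm := reCLM.circleAverage_comp_comm (c := 0) (R := 1) (f := poissonKernel 0 w • h)
      (hK.smul hhs).circleIntegrable'
    rw [← reCLM_apply, ← hcomm]
    refine circleAverage_mono (reCLM.continuous.comp_continuousOn (hK.smul hhs)).circleIntegrable'
      (hK.smul hcu).circleIntegrable' fun z hz => ?_
    simp only [Function.comp_apply, Pi.smul_apply', map_smul, reCLM_apply]
    refine smul_le_smul_of_nonneg_left ?_ (hK0 z hz)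
    rw [hre]
    have h1 := re_le_norm (starRingEnd ℂ c * f z)
    rw [norm_mul, norm_conj] at h1
    nlinarith [sq_nonneg (‖c‖ - ‖f z‖)]
  · rw [re_circleAverage_herglotzRieszKernel_smul hci (by simp)]
    refine circleAverage_congr_sphere fun z hz => ?_
    have hz1 : ‖z‖ = 1 := by simpa using hz
    have hz0 : z ≠ 0 := by
      rintro rfl
      simp at hz1
    simp [herglotzRieszKernel_def, hz0]

/-- On a circle centred at the origin, the squared modulus of a polynomial is the real part of a
polynomial whose value at the origin is the mean. -/
theorem Complex.exists_re_eq_norm_sum_sq (c : ℕ → ℂ) (s : Finset ℕ) (r : ℝ) :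
    ∃ Q : ℂ → ℂ, Differentiable ℂ Q ∧ (Q 0).re = ∑ k ∈ s, ‖c k‖ ^ 2 * r ^ (2 * k) ∧
      ∀ z, ‖z‖ = r → (Q z).re = ‖∑ k ∈ s, c k * z ^ k‖ ^ 2 := by
  -- On |z| = r, z̄ = r²/z turns each product c_i z^i · conj(c_j z^j) with j ≤ i into a monomial.
  -- For i < j its conjugate is used, which has the same real part. Only the diagonal survives at 0.
  refine ⟨fun z => ∑ i ∈ s, ∑ j ∈ s, if j ≤ i then c i * starRingEnd ℂ (c j) * r ^ (2 * j) *
    z ^ (i - j) else starRingEnd ℂ (c i) * c j * r ^ (2 * i) * z ^ (j - i), ?_, ?_, ?_⟩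
  · refine Differentiable.fun_sum fun i _ => Differentiable.fun_sum fun j _ => ?_
    split_ifs <;> fun_prop
  · rw [Complex.re_sum]
    refine Finset.sum_congr rfl fun i hi => ?_
    rw [Finset.sum_eq_single_of_mem i hi]
    · rw [if_pos le_rfl, Nat.sub_self, pow_zero, mul_one, Complex.mul_conj']
      norm_cast
    · intro j _ hj
      split_ifs with h
      · rw [zero_pow (by omega), mul_zero]
      · rw [zero_pow (by omega), mul_zero]
  · intro z hz
    have hzz : z * starRingEnd ℂ z = (r : ℂ) ^ 2 := by rw [Complex.mul_conj', hz]
    have key : ∀ i j : ℕ, j ≤ i →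
        c i * starRingEnd ℂ (c j) * (r : ℂ) ^ (2 * j) * z ^ (i - j)
          = c i * z ^ i * starRingEnd ℂ (c j * z ^ j) := by
      intro i j hij
      obtain ⟨m, rfl⟩ := Nat.exists_eq_add_of_le hij
      rw [Nat.add_sub_cancel_left, pow_mul, ← hzz, map_mul, map_pow, mul_pow, pow_add]
      ring
    have hn : ∀ w : ℂ, ‖w‖ ^ 2 = (w * starRingEnd ℂ w).re := by
      intro w
      rw [Complex.mul_conj']
      norm_cast
    rw [hn, map_sum, Finset.sum_mul_sum, Complex.re_sum, Complex.re_sum]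
    refine Finset.sum_congr rfl fun i _ => ?_
    rw [Complex.re_sum, Complex.re_sum]
    refine Finset.sum_congr rfl fun j _ => ?_
    split_ifs with h
    · rw [key i j h]
    · have := key j i (by omega)
      rw [mul_comm (starRingEnd ℂ (c i)) (c j), this, ← Complex.conj_re]
      congr 1
      simp
      ring

/-- Parseval for polynomials, from the mean value property of `Q`. -/
theorem circleAverage_norm_sum_sq (c : ℕ → ℂ) (s : Finset ℕ) :
    circleAverage (fun z => ‖∑ k ∈ s, c k * z ^ k‖ ^ 2) 0 1 = ∑ k ∈ s, ‖c k‖ ^ 2 := by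
  obtain ⟨Q, hQ, hQ0, hQn⟩ := Complex.exists_re_eq_norm_sum_sq c s 1
  have hmean : circleAverage Q 0 1 = Q 0 :=
    circleAverage_of_differentiable_on_off_countable Set.countable_empty hQ.continuous.continuousOn
      fun z _ => hQ z
  simp only [one_pow, mul_one] at hQ0
  rw [← hQ0, ← hmean, ← Complex.reCLM_apply,
    ← Complex.reCLM.circleAverage_comp_comm hQ.continuous.continuousOn.circleIntegrable']
  refine circleAverage_congr_sphere fun z hz => ?_
  simpa using (hQn z (by simpa using hz)).symm

/-! ### Power series on the unit disc -/

section PowerSeries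

variable {a : ℕ → ℂ} {f : ℂ → ℂ}

theorem summable_norm_mul_pow_of_hasSum
    (hf : ∀ z ∈ ball (0 : ℂ) 1, HasSum (fun n : ℕ => a (n + 1) * z ^ (n + 1)) (f z))
    {r : ℝ} (hr0 : 0 ≤ r) (hr1 : r < 1) : Summable fun n : ℕ => ‖a (n + 1)‖ * r ^ (n + 1) := by
  have h := (hf r (by simpa [abs_of_nonneg hr0] using hr1)).summable.norm
  simpa [abs_of_nonneg hr0] using h

theorem differentiableOn_of_hasSum
    (hf : ∀ z ∈ ball (0 : ℂ) 1, HasSum (fun n : ℕ => a (n + 1) * z ^ (n + 1)) (f z)) :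
    DifferentiableOn ℂ f (ball 0 1) := by
  intro z hz
  obtain ⟨r, hzr, hr1⟩ := exists_between (mem_ball_zero_iff.mp hz)
  have hr0 : 0 ≤ r := (norm_nonneg z).trans hzr.le
  have hd : DifferentiableOn ℂ (fun w => ∑' n : ℕ, a (n + 1) * w ^ (n + 1)) (ball 0 r) := by
    refine Complex.differentiableOn_tsum_of_summable_norm
      (summable_norm_mul_pow_of_hasSum hf hr0 hr1) (fun n => by fun_prop) isOpen_ball
      fun n w hw => ?_
    rw [norm_mul, norm_pow]
    gcongr
    exact (mem_ball_zero_iff.mp hw).le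
  have hd' : DifferentiableOn ℂ f (ball 0 r) :=
    hd.congr fun w hw => (hf w (ball_subset_ball hr1.le hw)).tsum_eq.symm
  exact (hd'.differentiableAt (isOpen_ball.mem_nhds (by simpa using hzr))).differentiableWithinAt

theorem eventually_norm_sub_partialSum_lt
    (hf : ∀ z ∈ ball (0 : ℂ) 1, HasSum (fun n : ℕ => a (n + 1) * z ^ (n + 1)) (f z))
    {r : ℝ} (hr0 : 0 ≤ r) (hr1 : r < 1) {δ : ℝ} (hδ : 0 < δ) :
    ∀ᶠ n in atTop, ∀ z ∈ closedBall (0 : ℂ) r, ‖f z - ∑ k ∈ Finset.Icc 1 n, a k * z ^ k‖ < δ := by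
  have hu := tendstoUniformlyOn_tsum_nat (f := fun (n : ℕ) (w : ℂ) => a (n + 1) * w ^ (n + 1))
    (s := closedBall 0 r) (summable_norm_mul_pow_of_hasSum hf hr0 hr1) (fun n w hw => by
      rw [norm_mul, norm_pow]
      gcongr
      exact mem_closedBall_zero_iff.mp hw)
  filter_upwards [Metric.tendstoUniformlyOn_iff.mp hu δ hδ] with n hn z hz
  have := hn z hz
  rw [(hf z (closedBall_subset_ball hr1 hz)).tsum_eq, dist_eq_norm] at this
  rwa [Finset.range_eq_Ico, Finset.sum_Ico_add' (fun k => a k * z ^ k) 0 n 1, zero_add,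
    Finset.Ico_add_one_right_eq_Icc] at this

theorem apply_zero_of_hasSum
    (hf : ∀ z ∈ ball (0 : ℂ) 1, HasSum (fun n : ℕ => a (n + 1) * z ^ (n + 1)) (f z)) : f 0 = 0 := by
  have h := hf 0 (by simp)
  simp only [ne_eq, Nat.add_eq_zero_iff, one_ne_zero, and_false, not_false_eq_true, zero_pow,
    mul_zero] at h
  exact h.unique hasSum_zero

/-- Used to show that `f` is nonconstant: otherwise `f`, hence `g`, would vanish identically,
against `b 1 ≠ 0`. -/
theorem coeff_one_eq_zero_of_hasSum
    (hf : ∀ z ∈ ball (0 : ℂ) 1, HasSum (fun n : ℕ => a (n + 1) * z ^ (n + 1)) (f z))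
    (h0 : ∀ z ∈ ball (0 : ℂ) 1, f z = 0) : a 1 = 0 := by
  have hp : HasFPowerSeriesAt f
      (FormalMultilinearSeries.ofScalars ℂ fun n => if n = 0 then 0 else a n) 0 := by
    rw [hasFPowerSeriesAt_iff]
    filter_upwards [isOpen_ball.mem_nhds (mem_ball_self (x := (0 : ℂ)) one_pos)] with z hz
    rw [← hasSum_nat_add_iff' 1]
    simpa [FormalMultilinearSeries.coeff_ofScalars, mul_comm] using hf z hz
  have hf0 : f =ᶠ[𝓝 0] 0 := by
    filter_upwards [isOpen_ball.mem_nhds (mem_ball_self (x := (0 : ℂ)) one_pos)] with z hz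
    exact h0 z hz
  have := (hp.congr hf0).eq_zero
  have h1 := congrArg (fun p : FormalMultilinearSeries ℂ ℂ ℂ => p.coeff 1) this
  simp only [FormalMultilinearSeries.coeff_ofScalars, one_ne_zero, if_false] at h1
  exact h1

/-- The boundary mean of the squared modulus is approximated from below by coefficient sums. -/
theorem exists_circleAverage_norm_sq_le_sum_add
    (hf : ∀ z ∈ ball (0 : ℂ) 1, HasSum (fun n : ℕ => a (n + 1) * z ^ (n + 1)) (f z))
    (hc : ContinuousOn f (closedBall 0 1)) {ε : ℝ} (hε : 0 < ε) :
    ∃ n : ℕ, circleAverage (fun z => ‖f z‖ ^ 2) 0 1 ≤ ∑ k ∈ Finset.Icc 1 n, ‖a k‖ ^ 2 + ε := by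
  obtain ⟨B, hB⟩ := (isCompact_closedBall (0 : ℂ) 1).exists_bound_of_continuousOn hc
  have hB0 : 0 ≤ B := (norm_nonneg _).trans (hB 0 (by simp))
  -- From ‖f‖ ≤ ‖p‖ + 2δ and ‖f‖ ≤ B follows ‖f‖² ≤ ‖p‖² + 4δB; the `+ 1` keeps the denominator
  -- positive.
  set δ := ε / (4 * (B + 1)) with hδdef
  have hδ : 0 < δ := by positivity
  have hδB : 4 * δ * B ≤ ε := by
    have : 4 * δ * (B + 1) = ε := by rw [hδdef]; field_simp
    nlinarith
  obtain ⟨τ, hτ, hunif⟩ := Metric.uniformContinuousOn_iff.mp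
    ((isCompact_closedBall (0 : ℂ) 1).uniformContinuousOn_of_continuous hc) δ hδ
  -- On the unit circle `f z` is within `δ` of `f (r * z)`, and that is within `δ` of a partial sum.
  -- The factors `r ^ k ≤ 1` only shrink the coefficients.
  obtain ⟨r, hr, hr1⟩ := exists_between (max_lt (sub_lt_self 1 hτ) (zero_lt_one' ℝ))
  obtain ⟨hrτ, hr0⟩ := max_lt_iff.mp hr
  obtain ⟨n, hn⟩ := (eventually_norm_sub_partialSum_lt hf hr0.le hr1 hδ).exists
  refine ⟨n, ?_⟩
  have hle : circleAverage (fun z => ‖f z‖ ^ 2) 0 1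
      ≤ circleAverage (fun z => ‖∑ k ∈ Finset.Icc 1 n, a k * r ^ k * z ^ k‖ ^ 2 + ε) 0 1 := by
    refine circleAverage_mono ?_ ?_ fun z hz => ?_
    · refine ContinuousOn.circleIntegrable' ?_
      rw [abs_one]
      exact (hc.mono sphere_subset_closedBall).norm.pow 2
    · exact ContinuousOn.circleIntegrable' (by fun_prop)
    · have hz1 : ‖z‖ = 1 := by simpa using hz
      have hrz : ‖(r : ℂ) * z‖ = r := by simp [hz1, abs_of_pos hr0]
      have h1 := hn (r * z) (by simp [hz1, abs_of_pos hr0])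
      have h2 := hunif z (by simp [hz1]) (r * z) (by rw [mem_closedBall_zero_iff, hrz]; exact hr1.le)
        (by
          rw [dist_eq_norm, show z - r * z = ((1 - r : ℝ) : ℂ) * z by push_cast; ring, norm_mul, hz1,
            Complex.norm_real, norm_of_nonneg (by linarith)]
          linarith)
      rw [dist_eq_norm] at h2
      have hp : ∑ k ∈ Finset.Icc 1 n, a k * (r * z) ^ k
          = ∑ k ∈ Finset.Icc 1 n, a k * r ^ k * z ^ k :=
        Finset.sum_congr rfl fun k _ => by rw [mul_pow]; ring
      rw [hp] at h1
      set p := ∑ k ∈ Finset.Icc 1 n, a k * r ^ k * z ^ k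
      have h3 : ‖f z‖ ≤ ‖p‖ + 2 * δ := by
        have e : f z = p + ((f z - f (r * z)) + (f (r * z) - p)) := by ring
        calc ‖f z‖ = ‖p + ((f z - f (r * z)) + (f (r * z) - p))‖ := by rw [← e]
          _ ≤ ‖p‖ + (‖f z - f (r * z)‖ + ‖f (r * z) - p‖) :=
            (norm_add_le _ _).trans (by gcongr; exact norm_add_le _ _)
          _ ≤ ‖p‖ + 2 * δ := by linarith
      have h4 := hB z (by simp [hz1])
      have h5 := norm_nonneg (f z)
      have h6 := norm_nonneg p
      nlinarith [sq_nonneg (‖f z‖ - ‖p‖), mul_nonneg hδ.le (sub_nonneg.mpr h4),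
        mul_nonneg h5 (sub_nonneg.mpr h3)]
  refine hle.trans ?_
  rw [circleAverage_fun_add (ContinuousOn.circleIntegrable' (by fun_prop))
    (circleIntegrable_const _ _ _), circleAverage_const,
    circleAverage_norm_sum_sq fun k => a k * (r : ℂ) ^ k]
  gcongr with k _
  rw [norm_mul, norm_pow, Complex.norm_real, norm_of_nonneg hr0.le]
  exact mul_le_of_le_one_right (norm_nonneg _) (pow_le_one₀ hr0.le hr1.le)

end PowerSeries

/-! ### Subordination and the coefficient inequality -/

/-- Littlewood subordination for the Hardy norm, with a proper map in place of a univalent one. -/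
theorem sum_norm_sq_le_circleAverage_of_isProperMap {a b : ℕ → ℂ} {f g : ℂ → ℂ}
    (hf : ∀ z ∈ ball (0 : ℂ) 1, HasSum (fun n : ℕ => a (n + 1) * z ^ (n + 1)) (f z))
    (hf_cont : ContinuousOn f (closedBall (0 : ℂ) 1))
    (hf_proper : IsProperMap ((ball (0 : ℂ) 1).imageFactorization f))
    (hg : ∀ z ∈ ball (0 : ℂ) 1, HasSum (fun n : ℕ => b (n + 1) * z ^ (n + 1)) (g z))
    (hgf : g '' ball (0 : ℂ) 1 ⊆ f '' ball (0 : ℂ) 1) (hb : b 1 ≠ 0) (n : ℕ) :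
    ∑ k ∈ Finset.Icc 1 n, ‖b k‖ ^ 2 ≤ circleAverage (fun z => ‖f z‖ ^ 2) 0 1 := by
  have hfd := differentiableOn_of_hasSum hf
  have hgd := differentiableOn_of_hasSum hg
  have hf0 := apply_zero_of_hasSum hf
  have hg0 := apply_zero_of_hasSum hg
  have hnc : ∀ x ∈ ball (0 : ℂ) 1, ¬ ∀ᶠ z in 𝓝 x, f z = f x := by
    intro x hx h
    have heq := (hfd.analyticOnNhd isOpen_ball).eqOn_of_preconnected_of_eventuallyEq
      (analyticOnNhd_const (v := f x)) (convex_ball (0 : ℂ) 1).isPreconnected hx h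
    refine hb (coeff_one_eq_zero_of_hasSum hg fun z hz => ?_)
    obtain ⟨w, hw, hwz⟩ := hgf ⟨z, hz, rfl⟩
    rw [← hwz, heq hw, ← hf0]
    exact (heq (mem_ball_self one_pos)).symm
  obtain ⟨F, hF, hFf, hF0⟩ := DiffContOnCl.exists_norm_sq_le_re (f := f)
    ⟨hfd, by rwa [closure_ball _ one_ne_zero]⟩
  obtain ⟨B, hB⟩ := (isCompact_closedBall (0 : ℂ) 1).exists_bound_of_continuousOn hf_cont
  have hB0 : 0 ≤ B := (norm_nonneg _).trans (hB 0 (by simp))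
  rw [← hF0]
  have hr : ∀ r : ℝ, 0 < r → r < 1 →
      ∑ k ∈ Finset.Icc 1 n, ‖b k‖ ^ 2 * r ^ (2 * k) ≤ (F 0).re := by
    intro r hr0 hr1
    refine le_of_forall_pos_le_add fun ε hε => ?_
    -- `δ < 1` and `δ * (2 * B + 1) < ε` ensure (‖g‖ + δ)² ≤ ‖g‖² + ε.
    obtain ⟨δ, hδ, hδ'⟩ := exists_between
      (lt_min one_pos (show 0 < ε / (2 * B + 1) by positivity))
    obtain ⟨hδ1, hδε⟩ := lt_min_iff.mp hδ'
    rw [lt_div_iff₀ (by positivity)] at hδε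
    -- The partial sum must be long enough to approximate `g` on the circle; its terms beyond `n`
    -- contribute nonnegatively and are dropped at the end.
    obtain ⟨N, hN, hnN⟩ := ((eventually_norm_sub_partialSum_lt hg hr0.le hr1 hδ).and
      (eventually_ge_atTop n)).exists
    obtain ⟨Q, hQ, hQ0, hQn⟩ := Complex.exists_re_eq_norm_sum_sq b (Finset.Icc 1 N) r
    have := hf_proper.re_zero_le_add (φ := fun w => ‖w‖ ^ 2) (δ := ε) hfd hnc hgd hgf
      (hf0.trans hg0.symm) hF hFf hQ.differentiableOn hr0 hr1 fun z hz => by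
        have hz1 : ‖z‖ = r := by simpa using hz
        rw [hQn z hz1]
        have h1 := hN z (sphere_subset_closedBall hz)
        set p := ∑ k ∈ Finset.Icc 1 N, b k * z ^ k
        obtain ⟨w, hw, hwz⟩ := hgf ⟨z, by simpa [hz1] using hr1, rfl⟩
        have h2 : ‖g z‖ ≤ B := hwz ▸ hB w (ball_subset_closedBall hw)
        have h3 : ‖p‖ ≤ ‖g z‖ + δ := by
          have := norm_sub_norm_le p (g z)
          rw [norm_sub_rev] at this
          linarith
        have h4 := norm_nonneg p
        have h5 := norm_nonneg (g z)
        calc ‖p‖ ^ 2 ≤ (‖g z‖ + δ) ^ 2 := by gcongr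
          _ = ‖g z‖ ^ 2 + δ * (2 * ‖g z‖ + δ) := by ring
          _ ≤ ‖g z‖ ^ 2 + δ * (2 * B + 1) := by gcongr
          _ ≤ ‖g z‖ ^ 2 + ε := by linarith
    rw [hQ0] at this
    refine le_trans (Finset.sum_le_sum_of_subset_of_nonneg
      (Finset.Icc_subset_Icc_right hnN) fun k _ _ => by positivity) this
  have ht : Tendsto (fun r : ℝ => ∑ k ∈ Finset.Icc 1 n, ‖b k‖ ^ 2 * r ^ (2 * k)) (𝓝[<] 1)
      (𝓝 (∑ k ∈ Finset.Icc 1 n, ‖b k‖ ^ 2)) := by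
    have hcont : Continuous (fun r : ℝ => ∑ k ∈ Finset.Icc 1 n, ‖b k‖ ^ 2 * r ^ (2 * k)) := by
      fun_prop
    simpa using (hcont.tendsto 1).mono_left nhdsWithin_le_nhds
  refine le_of_tendsto ht ?_
  filter_upwards [Ioo_mem_nhdsLT (zero_lt_one' ℝ)] with r hr'
  exact hr r hr'.1 hr'.2

theorem corollary10 (a b : ℕ → ℂ) (f g : ℂ → ℂ)
    (hf : ∀ z ∈ Metric.ball (0 : ℂ) 1,
      HasSum (fun n : ℕ => a (n + 1) * z ^ (n + 1)) (f z))
    (hf_cont : ContinuousOn f (Metric.closedBall (0 : ℂ) 1))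
    (hf_proper : IsProperMap (Set.imageFactorization f (Metric.ball (0 : ℂ) 1)))
    (hg : ∀ z ∈ Metric.ball (0 : ℂ) 1,
      HasSum (fun n : ℕ => b (n + 1) * z ^ (n + 1)) (g z))
    (hgf : g '' Metric.ball (0 : ℂ) 1 ⊆ f '' Metric.ball (0 : ℂ) 1)
    (hb : b 1 ≠ 0) :
    ∃ N : ℕ, 2 < N ∧ ∀ n : ℕ, N < n →
      ∑ k ∈ Finset.Icc 2 n, ‖b k‖ ^ 2 ≤ ∑ k ∈ Finset.Icc 1 n, ‖a k‖ ^ 2 := by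
  have hb' : 0 < ‖b 1‖ ^ 2 := by positivity
  -- The approximation error allowed is exactly the omitted term `‖b 1‖ ^ 2`.
  obtain ⟨m, hm⟩ := exists_circleAverage_norm_sq_le_sum_add hf hf_cont hb'
  refine ⟨m + 3, by omega, fun n hn => ?_⟩
  have h1 := sum_norm_sq_le_circleAverage_of_isProperMap hf hf_cont hf_proper hg hgf hb n
  have h2 : ∑ k ∈ Finset.Icc 1 n, ‖b k‖ ^ 2 = ‖b 1‖ ^ 2 + ∑ k ∈ Finset.Icc 2 n, ‖b k‖ ^ 2 := by
    rw [← Finset.add_sum_Ioc_eq_sum_Icc (by omega : 1 ≤ n)]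
    rfl
  have h3 : ∑ k ∈ Finset.Icc 1 m, ‖a k‖ ^ 2 ≤ ∑ k ∈ Finset.Icc 1 n, ‖a k‖ ^ 2 :=
    Finset.sum_le_sum_of_subset_of_nonneg (Finset.Icc_subset_Icc_right (by omega))
      fun k _ _ => by positivity
  linarith
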